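/- Let $U(t)=\exp(itA)$ ($t\in\mathbb{R}$) be the transition matrix of the continuous-time quantum walk on a finite graph $G$ with adjacency matrix $A$. Distinct vertices $a,b$ of $G$ exhibit pretty good state transfer (PGST) with respect to a sequence $(\tau_k)_{k\ge 1}$ of real numbers if $\lim_{k\to\infty}U(\tau_k)\mathbf{e}_a=\gamma\,\mathbf{e}_b$ for some $\gamma\in\mathbb{C}$; there is PGST between $a$ and $b$ if this holds for some real sequence, and there is no PGST from $a$ if there is no PGST between $a$ and any vertex $b\ne a$. For positive integers $l,m$, let $SK_{1,l}$ be the subdivided star obtained from $l$ copies of the path $P_3$ by identifying one end vertex of each copy into a single vertex (the coalescence vertex), and let $T_{l,m}$ be the graph obtained from the disjoint union of $SK_{1,l}$ and $SK_{1,m}$ by joining their coalescence vertices by an edge. In $T_{2,m}$, let $c,d$ be the two leaves of the two branches on the $SK_{1,2}$ side, and let $e,f$ be the degree-$2$ neighbours of $c,d$ respectively. **Theorem.** Let $m$ be a positive integer, and let $\pm\theta_1,\pm\theta_2,\pm\theta_3$ be the roots (in $\mathbb{C}$, with multiplicity) of $$q(x)=x^6-(m+5)x^4+(3m+5)x^2-1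 .$$ Then the following hold in $T_{2,m}$. 1. If $q(x)$ is irreducible over $\mathbb{Q}$, then there is a sequence in $(2\mathbb{Z}+1)\pi$ with respect to which there is PGST both between $c$ and $d$ and between $e$ and $f$. 2. Suppose that $q(x)$ is reducible over $\mathbb{Q}$. If $\theta_1+\theta_2+\theta_3$ is an even integer, then there is a sequence in $(2\mathbb{Z}+1)\pi$ with respect to which there is PGST both between $c$ and $d$ and between $e$ and $f$. If $\theta_1+\theta_2+\theta_3$ is an odd integer, then there is no PGST from any of the vertices $c,d,e,f$. -/

import Mathlib

open Polynomial Filter Topology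

/-- The transition matrix `U(t) = exp(i t A)` of the continuous-time quantum walk on a finite
graph `G` with adjacency matrix `A`. -/
noncomputable def transitionMatrix {V : Type*} [Fintype V] [DecidableEq V] (G : SimpleGraph V)
    [DecidableRel G.Adj] (t : ℝ) : Matrix V V ℂ :=
  NormedSpace.exp ((Complex.I * (t : ℂ)) • G.adjMatrix ℂ)

/-- Pretty good state transfer between the distinct vertices `a` and `b` with respect to the
sequence of times `τ`: `U(τ k) e_a → γ e_b` for some complex number `γ`. -/
def PGSTAlong {V : Type*} [Fintype V] [DecidableEq V] (G : SimpleGraph V)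
    [DecidableRel G.Adj] (τ : ℕ → ℝ) (a b : V) : Prop :=
  a ≠ b ∧ ∃ γ : ℂ,
    Tendsto (fun k => (transitionMatrix G (τ k)).mulVec (Pi.single a 1)) atTop
      (𝓝 (γ • (Pi.single b 1 : V → ℂ)))

/-- `G` exhibits pretty good state transfer between the vertices `a` and `b`. -/
def PGST {V : Type*} [Fintype V] [DecidableEq V] (G : SimpleGraph V)
    [DecidableRel G.Adj] (a b : V) : Prop :=
  ∃ τ : ℕ → ℝ, PGSTAlong G τ a b

/-- Vertices of the subdivided star with `l` branches: `none` is the coalescence vertex,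
`some (j, false)` the middle vertex and `some (j, true)` the leaf of the `j`-th branch. -/
abbrev StarVertex (l : ℕ) : Type := Option (Fin l × Bool)

/-- The coalescence vertex. -/
def StarVertex.center {l : ℕ} : StarVertex l := none

/-- The middle vertex of the `j`-th branch. -/
def StarVertex.middle {l : ℕ} (j : Fin l) : StarVertex l := some (j, false)

/-- The leaf of the `j`-th branch. -/
def StarVertex.leaf {l : ℕ} (j : Fin l) : StarVertex l := some (j, true)

/-- The subdivided star with `l` branches: `l` paths
`center - middle j - leaf j` glued along their common end vertex `center`. -/
def subdividedStar (l : ℕ) : SimpleGraph (StarVertex l) :=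
  SimpleGraph.fromRel fun u v => ∃ j : Fin l,
    (u = StarVertex.center ∧ v = StarVertex.middle j) ∨
    (u = StarVertex.middle j ∧ v = StarVertex.leaf j)

/-- The double subdivided star `T_{l,m}`: the disjoint union of the subdivided stars with `l` and
`m` branches together with an edge joining the two coalescence vertices. -/
def doubleSubdividedStar (l m : ℕ) : SimpleGraph (StarVertex l ⊕ StarVertex m) :=
  (subdividedStar l ⊕g subdividedStar m) ⊔
    SimpleGraph.edge (Sum.inl StarVertex.center) (Sum.inr StarVertex.center)

noncomputable instance doubleSubdividedStar.decidableRelAdj (l m : ℕ) :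
    DecidableRel (doubleSubdividedStar l m).Adj :=
  Classical.decRel _

/-- The middle vertex of the `j`-th branch on the `l`-branch side of `T_{l,m}`. -/
def leftMiddle {l m : ℕ} (j : Fin l) : StarVertex l ⊕ StarVertex m :=
  Sum.inl (StarVertex.middle j)

/-- The leaf of the `j`-th branch on the `l`-branch side of `T_{l,m}`. -/
def leftLeaf {l m : ℕ} (j : Fin l) : StarVertex l ⊕ StarVertex m :=
  Sum.inl (StarVertex.leaf j)

/-- `q(x) = x^6 - (m+5) x^4 + (3m+5) x^2 - 1`. -/
noncomputable def qPoly (m : ℕ) : ℚ[X] :=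
  X ^ 6 - C ((m : ℚ) + 5) * X ^ 4 + C (3 * (m : ℚ) + 5) * X ^ 2 - 1

/-- The set `(2ℤ + 1)π` of odd integer multiples of `π`. -/
def oddMultiplesOfPi : Set ℝ := {t | ∃ n : ℤ, t = (2 * (n : ℝ) + 1) * Real.pi}

/-! The difference vectors on the leaves c, d and on the middles e, f span the eigenvalues ±1.
Vectors constant on the branches of each side are killed by q(A). At odd multiples of π the
antisymmetric half of a basis vector changes sign. Hence PGST follows once exp(iτθ) → 1 for every
root θ of q along such times (`pgstAlong_of_tendsto`).

By Kronecker approximation (`exists_norm_mul_pow_sub_one_lt`, `exists_seq_odd_mul_pi`) such times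
exist if every integer relation Σ lᵢθᵢ = N has N even. Galois theory finds these relations: the θᵢ²
are conjugate roots of an irreducible cubic, and θ₁θ₂θ₃ = ±1 allows automorphisms only an even
number of sign changes. If q is irreducible, θ₁ and -θ₁ are conjugate and only the zero relation
survives. If Σ θᵢ is an integer n, signs never change and transitivity makes all lᵢ equal, so N is a
multiple of n.

Conversely, testing PGST against eigenvectors forces the target to be the mirror image, with exp(iτ)
→ -γ and exp(iτθ) → γ for all roots θ of q. The pair ±θ₁ gives γ² = 1, and an odd sum gives γ³ = -γ,
a contradiction. -/

/-! ### Kronecker approximation on a torus -/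

/-- The Cesàro means of `k ↦ z ^ k` converge to `1` or `0`, for `z` on the unit circle. -/
theorem tendsto_cesaro_pow {z : ℂ} (hz : ‖z‖ = 1) :
    Tendsto (fun T : ℕ => (T : ℂ)⁻¹ * ∑ k ∈ Finset.range T, z ^ k) atTop
      (𝓝 (if z = 1 then 1 else 0)) := by
  split_ifs with h
  · subst h
    refine tendsto_const_nhds.congr' ?_
    filter_upwards [eventually_ne_atTop 0] with T hT
    simp [hT]
  · have hz1 : z - 1 ≠ 0 := sub_ne_zero.2 h
    refine squeeze_zero_norm (a := fun T : ℕ => (T : ℝ)⁻¹ * (2 / ‖z - 1‖)) (fun T => ?_) ?_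
    · rw [norm_mul, norm_inv, Complex.norm_natCast, geom_sum_eq h, norm_div]
      gcongr
      calc ‖z ^ T - 1‖ ≤ ‖z ^ T‖ + ‖(1 : ℂ)‖ := norm_sub_le _ _
        _ = 2 := by rw [norm_pow, hz]; norm_num
    · simpa using (tendsto_inv_atTop_nhds_zero_nat (𝕜 := ℝ)).mul_const (2 / ‖z - 1‖)

/-- On the unit circle this kernel equals ‖1 + x‖^(2N). By the parallelogram law it is exponentially
smaller away from x = 1 than its peak 4^N. -/
theorem norm_one_add_pow_le {x : ℂ} (hx : ‖x‖ = 1) {ε : ℝ} (hε : 0 ≤ ε) (h : ε ≤ ‖x - 1‖) (N : ℕ) :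
    ‖(1 + x) ^ (2 * N) * (x ^ N)⁻¹‖ ≤ (4 - ε ^ 2) ^ N := by
  have hpar : ‖1 + x‖ ^ 2 + ‖x - 1‖ ^ 2 = 4 := by
    have := parallelogram_law_with_norm ℝ x 1
    rw [add_comm 1 x, this, hx]; norm_num
  rw [norm_mul, norm_inv, norm_pow, norm_pow, hx, one_pow, inv_one, mul_one, pow_mul]
  gcongr
  nlinarith [pow_le_pow_left₀ hε h 2]

theorem one_add_pow_mul_inv_eq_sum (N : ℕ) (x : ℂ) (hx : x ≠ 0) :
    (1 + x) ^ (2 * N) * (x ^ N)⁻¹ =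
      ∑ i ∈ Finset.range (2 * N + 1), ((2 * N).choose i : ℂ) * x ^ ((i : ℤ) - N) := by
  rw [add_comm, add_pow, Finset.sum_mul]
  refine Finset.sum_congr rfl fun i _ => ?_
  rw [zpow_sub₀ hx, zpow_natCast, zpow_natCast]
  simp; ring

/-- An inhomogeneous Kronecker approximation theorem on a torus: if every character that is
trivial at `z` is trivial at `w`, then the coset `w z ^ k` comes arbitrarily close to `1`. -/
theorem exists_norm_mul_pow_sub_one_lt {ι : Type*} [Fintype ι] (z w : ι → ℂ)
    (hz : ∀ j, ‖z j‖ = 1) (hw : ∀ j, ‖w j‖ = 1)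
    (h : ∀ l : ι → ℤ, ∏ j, z j ^ l j = 1 → ∏ j, w j ^ l j = 1) {ε : ℝ} (hε : 0 < ε) :
    ∃ k : ℕ, ∀ j, ‖w j * z j ^ k - 1‖ < ε := by
  classical
  by_contra! hcon
  -- The cap at 2 keeps 4 - δ² nonnegative.
  obtain ⟨δ, hδ0, hδε, hδ2⟩ : ∃ δ : ℝ, 0 < δ ∧ δ ≤ ε ∧ δ ≤ 2 :=
    ⟨min ε 2, by positivity, min_le_left _ _, min_le_right _ _⟩
  have hz0 : ∀ j, z j ≠ 0 := fun j => norm_ne_zero_iff.1 (by simp [hz])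
  have hw0 : ∀ j, w j ≠ 0 := fun j => norm_ne_zero_iff.1 (by simp [hw])
  set d := Fintype.card ι with hd
  -- Average the product kernel over the orbit. Above, some coordinate is always far from 1; below,
  -- the mean is at least the coefficient of the trivial character.
  have key : ∀ N : ℕ, (((2 * N).choose N : ℝ)) ^ d ≤ (4 - δ ^ 2) ^ N * (4 ^ N) ^ (d - 1) := by
    intro N
    let K : ℕ → ℂ := fun k => ∏ j, ((1 + w j * z j ^ k) ^ (2 * N) * ((w j * z j ^ k) ^ N)⁻¹)
    have hK : ∀ k, ‖K k‖ ≤ (4 - δ ^ 2) ^ N * (4 ^ N) ^ (d - 1) := by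
      intro k
      obtain ⟨j, hj⟩ := hcon k
      have hu : ∀ i, ‖w i * z i ^ k‖ = 1 := fun i => by simp [hw, hz]
      simp only [K]
      rw [norm_prod, ← Finset.mul_prod_erase _ _ (Finset.mem_univ j)]
      have h4 : (0:ℝ) ≤ 4 - δ ^ 2 := by nlinarith
      gcongr
      · exact norm_one_add_pow_le (hu j) hδ0.le (hδε.trans hj) N
      · calc _ ≤ ∏ i ∈ Finset.univ.erase j, (4 : ℝ) ^ N := by
              refine Finset.prod_le_prod (fun _ _ => norm_nonneg _) fun i _ => ?_
              simpa using norm_one_add_pow_le (hu i) le_rfl (norm_nonneg _) N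
          _ = _ := by rw [Finset.prod_const, Finset.card_erase_of_mem (Finset.mem_univ j),
                        Finset.card_univ]
    let S := Fintype.piFinset fun _ : ι => Finset.range (2 * N + 1)
    let c : (ι → ℕ) → ℝ := fun p => ∏ j, ((2 * N).choose (p j) : ℝ)
    let W : (ι → ℕ) → ℂ := fun p => ∏ j, w j ^ ((p j : ℤ) - N)
    let Z : (ι → ℕ) → ℂ := fun p => ∏ j, z j ^ ((p j : ℤ) - N)
    have hZ : ∀ p, ‖Z p‖ = 1 := fun p => by simp [Z, hz]
    have hKsum : ∀ k, K k = ∑ p ∈ S, (c p * W p) * Z p ^ k := by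
      intro k
      simp only [K]
      rw [Finset.prod_congr rfl fun j _ => one_add_pow_mul_inv_eq_sum N (w j * z j ^ k)
        (mul_ne_zero (hw0 j) (pow_ne_zero _ (hz0 j))), Finset.prod_univ_sum]
      refine Finset.sum_congr rfl fun p _ => ?_
      simp only [c, W, Z, Complex.ofReal_prod, Complex.ofReal_natCast, ← Finset.prod_pow,
        ← Finset.prod_mul_distrib]
      refine Finset.prod_congr rfl fun j _ => ?_
      rw [mul_zpow, ← zpow_natCast, ← zpow_natCast, ← zpow_mul, ← zpow_mul, mul_comm (k : ℤ)]
      ring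
    -- Only characters trivial at z survive averaging, and by `h` their values at w are 1, so the
    -- mean is a sum of nonnegative terms.
    have hlim : Tendsto (fun T : ℕ => (T : ℂ)⁻¹ * ∑ k ∈ Finset.range T, K k) atTop
        (𝓝 (((∑ p ∈ S, c p * if Z p = 1 then 1 else 0 : ℝ)) : ℂ)) := by
      have h1 : Tendsto (fun T : ℕ => ∑ p ∈ S, (c p * W p) *
          ((T : ℂ)⁻¹ * ∑ k ∈ Finset.range T, Z p ^ k)) atTop
          (𝓝 (∑ p ∈ S, (c p * W p) * if Z p = 1 then 1 else 0)) :=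
        tendsto_finsetSum _ fun p _ => (tendsto_cesaro_pow (hZ p)).const_mul _
      convert h1 using 2
      · simp only [hKsum, Finset.mul_sum]
        rw [Finset.sum_comm]
        exact Finset.sum_congr rfl fun p _ => Finset.sum_congr rfl fun k _ => by ring
      · push_cast
        refine Finset.sum_congr rfl fun p _ => ?_
        split_ifs with hp
        · simp only [W]
          rw [h _ hp]; simp
        · simp
    have hle : ‖((∑ p ∈ S, c p * if Z p = 1 then 1 else 0 : ℝ) : ℂ)‖ ≤
        (4 - δ ^ 2) ^ N * (4 ^ N) ^ (d - 1) := by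
      refine le_of_tendsto hlim.norm ?_
      filter_upwards [eventually_gt_atTop 0] with T hT
      rw [norm_mul, norm_inv, Complex.norm_natCast]
      have hT' : (0 : ℝ) < T := by exact_mod_cast hT
      rw [inv_mul_le_iff₀ hT']
      calc _ ≤ ∑ k ∈ Finset.range T, ‖K k‖ := norm_sum_le _ _
        _ ≤ ∑ k ∈ Finset.range T, (4 - δ ^ 2) ^ N * (4 ^ N) ^ (d - 1) :=
          Finset.sum_le_sum fun k _ => hK k
        _ = _ := by simp
    have hc : ∀ p, 0 ≤ c p := fun p => Finset.prod_nonneg fun _ _ => Nat.cast_nonneg _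
    rw [Complex.norm_real, Real.norm_eq_abs] at hle
    refine le_trans ?_ ((le_abs_self _).trans hle)
    have hmem : (fun _ : ι => N) ∈ S := by
      simp only [S, Fintype.mem_piFinset, Finset.mem_range]; intro; omega
    refine le_trans (le_of_eq ?_) (Finset.single_le_sum
      (f := fun p => c p * if Z p = 1 then 1 else 0) (fun p _ => ?_) hmem)
    · simp [c, Z, hd]
    · have := hc p
      positivity
  rcases Nat.eq_zero_or_pos d with h0 | hpos
  · obtain ⟨j, -⟩ := hcon 0
    exact absurd (Fintype.card_pos_iff.2 ⟨j⟩) (by omega)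
  set r : ℝ := (4 - δ ^ 2) / 4 with hr
  have hr0 : 0 ≤ r := by rw [hr]; nlinarith
  have hr1 : r < 1 := by rw [hr]; nlinarith
  -- The central binomial coefficient loses only a factor 2N + 1 ≤ 3N against 4^N, which cannot
  -- offset the geometric decay r^N.
  have hbound : ∀ N : ℕ, 1 ≤ N → (1 : ℝ) ≤ 3 ^ d * ((N : ℝ) ^ d * r ^ N) := by
    intro N hN
    have hN' : (1 : ℝ) ≤ N := by exact_mod_cast hN
    have h1 : (4 : ℝ) ^ N ≤ (2 * N + 1) * (2 * N).choose N := by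
      exact_mod_cast Nat.four_pow_le_two_mul_add_one_mul_central_binom N
    have h2 : ((4 : ℝ) ^ N) ^ d ≤ (3 * N) ^ d * ((r * 4) ^ N * (4 ^ N) ^ (d - 1)) := by
      calc ((4 : ℝ) ^ N) ^ d ≤ ((2 * N + 1) * (2 * N).choose N) ^ d := by gcongr
        _ = (2 * N + 1) ^ d * ((2 * N).choose N : ℝ) ^ d := mul_pow _ _ _
        _ ≤ (3 * N) ^ d * ((r * 4) ^ N * (4 ^ N) ^ (d - 1)) := by
          have : r * 4 = 4 - δ ^ 2 := by rw [hr]; ring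
          rw [this]
          gcongr
          · linarith
          · exact key N
    have h3 : ((4 : ℝ) ^ N) ^ d = 4 ^ N * (4 ^ N) ^ (d - 1) := by
      rw [← pow_succ', Nat.sub_add_cancel hpos]
    have h4 : (0 : ℝ) < ((4 : ℝ) ^ N) ^ d := by positivity
    refine le_of_mul_le_mul_right ?_ h4
    rw [one_mul]
    refine h2.trans (le_of_eq ?_)
    rw [h3, mul_pow, mul_pow]; ring
  have hlim := (tendsto_pow_const_mul_const_pow_of_abs_lt_one d
    (abs_lt.2 ⟨by linarith, hr1⟩)).const_mul ((3 : ℝ) ^ d)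
  rw [mul_zero] at hlim
  have := ge_of_tendsto hlim ((eventually_ge_atTop 1).mono hbound)
  linarith

/-! ### Quantum walk on eigenvectors -/

open NormedSpace in
theorem exp_mulVec_of_eigenvector {n : Type*} [Fintype n] [DecidableEq n] {M : Matrix n n ℂ}
    {v : n → ℂ} {μ : ℂ} (h : M.mulVec v = μ • v) :
    (NormedSpace.exp M).mulVec v = Complex.exp μ • v := by
  let _ : NormedRing (Matrix n n ℂ) := Matrix.linftyOpNormedRing
  let _ : NormedAlgebra ℂ (Matrix n n ℂ) := Matrix.linftyOpNormedAlgebra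
  have hpow : ∀ k : ℕ, (M ^ k).mulVec v = μ ^ k • v := by
    intro k
    induction k with
    | zero => simp
    | succ k ih => rw [pow_succ', ← Matrix.mulVec_mulVec, ih, Matrix.mulVec_smul, h, smul_smul,
        ← pow_succ]
  have hM := exp_series_hasSum_exp' (𝕂 := ℂ) M
  have hμ := exp_series_hasSum_exp' (𝕂 := ℂ) μ
  let L : Matrix n n ℂ →ₗ[ℂ] (n → ℂ) :=
    { toFun := fun N => N.mulVec v
      map_add' := fun a b => Matrix.add_mulVec a b v
      map_smul' := fun c a => Matrix.smul_mulVec c a v }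
  have hL : Continuous L := L.continuous_of_finiteDimensional
  have h1 := hM.map L hL
  have h2 : HasSum (fun k : ℕ => ((k.factorial⁻¹ : ℂ) • μ ^ k) • v) (NormedSpace.exp μ • v) :=
    hμ.smul_const v
  rw [← Complex.exp_eq_exp_ℂ] at h2
  refine h1.unique ?_
  convert h2 using 2 with k
  change ((k.factorial⁻¹ : ℂ) • M ^ k).mulVec v = _
  rw [Matrix.smul_mulVec, hpow, smul_smul, smul_eq_mul]

section Walk

variable {V : Type*} [Fintype V] [DecidableEq V] {G : SimpleGraph V} [DecidableRel G.Adj]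

theorem transitionMatrix_mulVec_of_eigenvector {v : V → ℂ} {μ : ℂ}
    (h : (G.adjMatrix ℂ).mulVec v = μ • v) (t : ℝ) :
    (transitionMatrix G t).mulVec v = Complex.exp (Complex.I * t * μ) • v :=
  exp_mulVec_of_eigenvector (by rw [Matrix.smul_mulVec, h, smul_smul])

theorem transitionMatrix_transpose (t : ℝ) :
    (transitionMatrix G t).transpose = transitionMatrix G t := by
  rw [transitionMatrix, ← Matrix.exp_transpose, Matrix.transpose_smul,
    SimpleGraph.transpose_adjMatrix]

/-- Testing state transfer from `a` to `b` against an eigenvector. -/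
theorem PGSTAlong.exists_tendsto {τ : ℕ → ℝ} {a b : V} (h : PGSTAlong G τ a b) :
    ∃ γ : ℂ, ∀ (v : V → ℂ) (μ : ℂ), (G.adjMatrix ℂ).mulVec v = μ • v →
      Tendsto (fun k => Complex.exp (Complex.I * τ k * μ) * v a) atTop (𝓝 (γ * v b)) := by
  obtain ⟨-, γ, hγ⟩ := h
  refine ⟨γ, fun v μ hv => ?_⟩
  have hc : Continuous fun x : V → ℂ => v ⬝ᵥ x := by
    unfold dotProduct; fun_prop
  have := (hc.tendsto _).comp hγ
  convert this using 2
  · simp only [Function.comp]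
    rw [Matrix.dotProduct_mulVec, ← Matrix.mulVec_transpose, transitionMatrix_transpose,
      transitionMatrix_mulVec_of_eigenvector hv]
    simp
  · simp

/-- The Lagrange basis polynomials at the points of `s` sum to 1, and X - μ times the one at μ is a
multiple of the annihilating product. Evaluated at `M` they project `x` to eigenvectors. -/
theorem eq_sum_eigenvectors {n : Type*} [Fintype n] [DecidableEq n] (M : Matrix n n ℂ)
    (s : Finset ℂ) (x : n → ℂ) (h : (aeval M (∏ μ ∈ s, (X - C μ))).mulVec x = 0) :
    ∃ y : ℂ → n → ℂ, x = ∑ μ ∈ s, y μ ∧ ∀ μ ∈ s, M.mulVec (y μ) = μ • y μ := by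
  rcases s.eq_empty_or_nonempty with rfl | hs
  · exact ⟨0, by simpa using h, by simp⟩
  refine ⟨fun μ => (aeval M (Lagrange.basis s id μ)).mulVec x, ?_, fun μ hμ => ?_⟩
  · rw [← Matrix.sum_mulVec, ← map_sum, Lagrange.sum_basis (Function.injective_id.injOn) hs]
    simp
  · have hprod : ∃ c : ℂ, (X - C μ) * Lagrange.basis s id μ = C c * ∏ ν ∈ s, (X - C ν) := by
      refine ⟨∏ ν ∈ s.erase μ, (μ - ν)⁻¹, ?_⟩
      rw [← Finset.mul_prod_erase s _ hμ, Lagrange.basis]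
      simp only [Lagrange.basisDivisor, Finset.prod_mul_distrib, id, map_prod]
      ring
    obtain ⟨c, hc⟩ := hprod
    have h2 : (aeval M ((X - C μ) * Lagrange.basis s id μ)).mulVec x = 0 := by
      rw [hc, map_mul, ← Matrix.mulVec_mulVec, h, Matrix.mulVec_zero]
    rw [map_mul, ← Matrix.mulVec_mulVec, map_sub, aeval_X, aeval_C, Matrix.sub_mulVec,
      Algebra.algebraMap_eq_smul_one, Matrix.smul_mulVec, Matrix.one_mulVec, sub_eq_zero] at h2
    exact h2

theorem tendsto_transitionMatrix_mulVec {τ : ℕ → ℝ} (s : Finset ℂ) {x : V → ℂ}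
    (h : (aeval (G.adjMatrix ℂ) (∏ μ ∈ s, (X - C μ))).mulVec x = 0)
    (hτ : ∀ μ ∈ s, Tendsto (fun k => Complex.exp (Complex.I * τ k * μ)) atTop (𝓝 1)) :
    Tendsto (fun k => (transitionMatrix G (τ k)).mulVec x) atTop (𝓝 x) := by
  obtain ⟨y, hxy, hy⟩ := eq_sum_eigenvectors _ s x h
  have h1 : Tendsto (fun k => ∑ μ ∈ s, Complex.exp (Complex.I * τ k * μ) • y μ) atTop
      (𝓝 (∑ μ ∈ s, (1 : ℂ) • y μ)) :=
    tendsto_finsetSum _ fun μ hμ => (hτ μ hμ).smul_const _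
  simp only [one_smul, ← hxy] at h1
  refine h1.congr fun k => ?_
  conv_rhs => rw [hxy, Matrix.mulVec_sum]
  exact Finset.sum_congr rfl fun μ hμ => (transitionMatrix_mulVec_of_eigenvector (hy μ hμ) _).symm

end Walk

/-! ### Eigenvectors of T_{2,m} and state transfer -/

/-- The vector on `T_{2,m}` that is constant on the leaves and on the middle vertices of the
`m`-branch side. -/
def branchVec (m : ℕ) (leaf middle : Fin 2 → ℂ) (u v middle' leaf' : ℂ) :
    StarVertex 2 ⊕ StarVertex m → ℂ
  | Sum.inl none => u
  | Sum.inl (some (j, false)) => middle j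
  | Sum.inl (some (j, true)) => leaf j
  | Sum.inr none => v
  | Sum.inr (some (_, false)) => middle'
  | Sum.inr (some (_, true)) => leaf'

/-- These vectors form an invariant subspace, which reduces all spectral computations to their
parameters. -/
theorem adjMatrix_mulVec_branchVec (m : ℕ) (l e : Fin 2 → ℂ) (u v e' l' : ℂ) :
    ((doubleSubdividedStar 2 m).adjMatrix ℂ).mulVec (branchVec m l e u v e' l') =
      branchVec m e (fun j => l j + u) (e 0 + e 1 + v) (u + m * e') (v + l') e' := by
  funext i
  simp only [Matrix.mulVec, dotProduct, SimpleGraph.adjMatrix_apply, Fintype.sum_sum_type,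
    Fintype.sum_option, Fintype.sum_prod_type, Fintype.sum_bool]
  rcases i with (_ | ⟨j, _ | _⟩) | (_ | ⟨j, _ | _⟩) <;>
  simp [doubleSubdividedStar, SimpleGraph.edge_adj, subdividedStar, StarVertex.center,
    StarVertex.middle, StarVertex.leaf, branchVec, Finset.sum_ite_eq, add_comm]
  all_goals fin_cases j <;> simp [add_comm]

theorem smul_branchVec (m : ℕ) (a : ℂ) (l e : Fin 2 → ℂ) (u v e' l' : ℂ) :
    a • branchVec m l e u v e' l' =
      branchVec m (a • l) (a • e) (a * u) (a * v) (a * e') (a * l') := by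
  funext i
  rcases i with (_ | ⟨j, _ | _⟩) | (_ | ⟨j, _ | _⟩) <;> simp [branchVec]

theorem branchVec_add (m : ℕ) (l e l₂ e₂ : Fin 2 → ℂ) (u v e' l' u₂ v₂ e₂' l₂' : ℂ) :
    branchVec m l e u v e' l' + branchVec m l₂ e₂ u₂ v₂ e₂' l₂' =
      branchVec m (l + l₂) (e + e₂) (u + u₂) (v + v₂) (e' + e₂') (l' + l₂') := by
  funext i
  rcases i with (_ | ⟨j, _ | _⟩) | (_ | ⟨j, _ | _⟩) <;> simp [branchVec]

theorem single_leftLeaf (m : ℕ) (j : Fin 2) :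
    (Pi.single (leftLeaf j) 1 : StarVertex 2 ⊕ StarVertex m → ℂ) =
      branchVec m (Pi.single j 1) 0 0 0 0 0 := by
  funext i
  rcases i with (_ | ⟨k, _ | _⟩) | (_ | ⟨k, _ | _⟩) <;>
    simp [branchVec, leftLeaf, StarVertex.leaf, Pi.single_apply]

theorem single_leftMiddle (m : ℕ) (j : Fin 2) :
    (Pi.single (leftMiddle j) 1 : StarVertex 2 ⊕ StarVertex m → ℂ) =
      branchVec m 0 (Pi.single j 1) 0 0 0 0 := by
  funext i
  rcases i with (_ | ⟨k, _ | _⟩) | (_ | ⟨k, _ | _⟩) <;>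
    simp [branchVec, leftMiddle, StarVertex.middle, Pi.single_apply]

theorem qPoly_map (m : ℕ) {K : Type*} [Field K] [Algebra ℚ K] :
    (qPoly m).map (algebraMap ℚ K) =
      X ^ 6 - C ((m : K) + 5) * X ^ 4 + C (3 * (m : K) + 5) * X ^ 2 - 1 := by
  simp [qPoly]

/-- q is the characteristic polynomial of the action on the six cells of the branch-symmetric
partition. -/
theorem aeval_qPoly_map_mulVec (m : ℕ) (l e u v e' l' : ℂ) :
    (aeval ((doubleSubdividedStar 2 m).adjMatrix ℂ)
      ((qPoly m).map (algebraMap ℚ ℂ))).mulVec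
        (branchVec m (fun _ => l) (fun _ => e) u v e' l') = 0 := by
  rw [qPoly_map]
  simp only [map_sub (aeval _), map_add (aeval _), map_mul (aeval _), map_pow (aeval _), aeval_X,
    aeval_C, map_one (aeval _), Matrix.sub_mulVec,
    Matrix.add_mulVec, Algebra.algebraMap_eq_smul_one, Matrix.smul_mulVec, Matrix.one_mulVec,
    smul_mul_assoc, one_mul]
  simp only [pow_succ, pow_zero, one_mul, ← Matrix.mulVec_mulVec, adjMatrix_mulVec_branchVec]
  funext i
  rcases i with (_ | ⟨j, _ | _⟩) | (_ | ⟨j, _ | _⟩) <;> simp [branchVec] <;> ring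

/-- The vector antisymmetric in the two branches, with eigenvalue `μ = ±1`. -/
theorem adjMatrix_mulVec_antisymm (m : ℕ) {μ : ℂ} (hμ : μ ^ 2 = 1) :
    ((doubleSubdividedStar 2 m).adjMatrix ℂ).mulVec
      (branchVec m ![1, -1] (μ • ![1, -1]) 0 0 0 0) =
        μ • branchVec m ![1, -1] (μ • ![1, -1]) 0 0 0 0 := by
  rw [adjMatrix_mulVec_branchVec, smul_branchVec, smul_smul, ← pow_two, hμ]
  congr 1 <;> simp

theorem exp_odd_mul_pi {t : ℝ} (ht : t ∈ oddMultiplesOfPi) : Complex.exp (Complex.I * t) = -1 := by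
  obtain ⟨n, rfl⟩ := ht
  have : Complex.I * ((2 * (n : ℝ) + 1) * Real.pi : ℝ) =
      Real.pi * Complex.I + n * (2 * Real.pi * Complex.I) := by push_cast; ring
  rw [this, Complex.exp_add, Complex.exp_pi_mul_I, Complex.exp_int_mul_two_pi_mul_I, mul_one]

theorem transitionMatrix_mulVec_antisymm (m : ℕ) {t : ℝ} (ht : t ∈ oddMultiplesOfPi) (a b : ℂ) :
    (transitionMatrix (doubleSubdividedStar 2 m) t).mulVec
      (branchVec m (a • ![1, -1]) (b • ![1, -1]) 0 0 0 0) =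
        - branchVec m (a • ![1, -1]) (b • ![1, -1]) 0 0 0 0 := by
  have h1 := exp_odd_mul_pi ht
  have h2 : Complex.exp (Complex.I * t * (-1)) = -1 := by
    rw [mul_neg_one, Complex.exp_neg, h1]; norm_num
  have hp := transitionMatrix_mulVec_of_eigenvector
    (adjMatrix_mulVec_antisymm m (μ := 1) (by norm_num)) t
  have hn := transitionMatrix_mulVec_of_eigenvector
    (adjMatrix_mulVec_antisymm m (μ := -1) (by norm_num)) t
  rw [mul_one, h1] at hp
  rw [h2] at hn
  have hdec : branchVec m (a • ![1, -1]) (b • ![1, -1]) 0 0 0 0 =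
      ((a + b) / 2) • branchVec m ![1, -1] ((1 : ℂ) • ![1, -1]) 0 0 0 0 +
      ((a - b) / 2) • branchVec m ![1, -1] ((-1 : ℂ) • ![1, -1]) 0 0 0 0 := by
    rw [smul_branchVec, smul_branchVec, branchVec_add, smul_smul, smul_smul, ← add_smul, ← add_smul]
    congr 2 <;> ring
  rw [hdec, Matrix.mulVec_add, Matrix.mulVec_smul, Matrix.mulVec_smul, hp, hn]
  simp only [neg_smul, one_smul, smul_neg, neg_add]

/-- If all the eigenvalue phases on the symmetric part tend to `1` along odd multiples of `π`,
then there is pretty good state transfer between the two branches. -/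
theorem pgstAlong_of_tendsto (m : ℕ) (s : Finset ℂ)
    (hs : (qPoly m).map (algebraMap ℚ ℂ) = ∏ μ ∈ s, (X - C μ)) {τ : ℕ → ℝ}
    (hτ : ∀ k, τ k ∈ oddMultiplesOfPi)
    (hlim : ∀ μ ∈ s, Tendsto (fun k => Complex.exp (Complex.I * τ k * μ)) atTop (𝓝 1)) :
    PGSTAlong (doubleSubdividedStar 2 m) τ (leftLeaf 0) (leftLeaf 1) ∧
      PGSTAlong (doubleSubdividedStar 2 m) τ (leftMiddle 0) (leftMiddle 1) := by
  have key : ∀ a b : ℂ, Tendsto (fun k => (transitionMatrix (doubleSubdividedStar 2 m) (τ k)).mulVec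
      (branchVec m (a • Pi.single 0 1) (b • Pi.single 0 1) 0 0 0 0)) atTop
      (𝓝 (branchVec m (a • Pi.single 1 1) (b • Pi.single 1 1) 0 0 0 0)) := by
    intro a b
    -- Symmetric plus antisymmetric half. The scalars `a`, `b` treat leaves and middles together.
    have h0 : branchVec m (a • Pi.single 0 1) (b • Pi.single 0 1) 0 0 0 0 =
        branchVec m (fun _ => a / 2) (fun _ => b / 2) 0 0 0 0 +
        branchVec m ((a / 2) • ![1, -1]) ((b / 2) • ![1, -1]) 0 0 0 0 := by
      rw [branchVec_add]
      congr 1 <;> first | (funext j; fin_cases j <;> simp) | simp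
    have h1 : branchVec m (a • Pi.single 1 1) (b • Pi.single 1 1) 0 0 0 0 =
        branchVec m (fun _ => a / 2) (fun _ => b / 2) 0 0 0 0 +
        -branchVec m ((a / 2) • ![1, -1]) ((b / 2) • ![1, -1]) 0 0 0 0 := by
      rw [← neg_one_smul ℂ, smul_branchVec, branchVec_add]
      congr 1 <;> first | (funext j; fin_cases j <;> simp) | simp
    rw [h0, h1]
    simp only [Matrix.mulVec_add, transitionMatrix_mulVec_antisymm m (hτ _)]
    refine Tendsto.add_const _ (tendsto_transitionMatrix_mulVec s ?_ hlim)
    rw [← hs]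
    exact aeval_qPoly_map_mulVec m _ _ _ _ _ _
  refine ⟨⟨by simp [leftLeaf, StarVertex.leaf], 1, ?_⟩,
    ⟨by simp [leftMiddle, StarVertex.middle], 1, ?_⟩⟩
  · rw [single_leftLeaf, single_leftLeaf, one_smul]
    simpa using key 1 0
  · rw [single_leftMiddle, single_leftMiddle, one_smul]
    simpa using key 0 1

/-- The eigenvector of `T_{2,m}` that is symmetric under all permutations of the branches. -/
theorem adjMatrix_mulVec_symm (m : ℕ) (hm : m ≠ 0) {μ : ℂ}
    (hμ : μ ^ 6 - (m + 5) * μ ^ 4 + (3 * m + 5) * μ ^ 2 - 1 = 0) :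
    ∃ u v e' l' : ℂ, ((doubleSubdividedStar 2 m).adjMatrix ℂ).mulVec
      (branchVec m (fun _ => 1) (fun _ => μ) u v e' l') =
        μ • branchVec m (fun _ => 1) (fun _ => μ) u v e' l' := by
  have hm' : (m : ℂ) ≠ 0 := by exact_mod_cast hm
  -- Solve the eigenvalue equation outward from the leaves with value 1; the last equation, at the
  -- far leaves, is q(μ) = 0.
  refine ⟨μ ^ 2 - 1, μ ^ 3 - 3 * μ, (μ ^ 4 - 4 * μ ^ 2 + 1) / m,
    μ * ((μ ^ 4 - 4 * μ ^ 2 + 1) / m) - (μ ^ 3 - 3 * μ), ?_⟩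
  rw [adjMatrix_mulVec_branchVec, smul_branchVec]
  congr 1
  · funext j; simp
  · funext j; simp; ring
  · ring
  · field_simp; ring
  · ring
  · field_simp
    linear_combination (-1) * hμ

theorem norm_exp_I_mul_mul {t : ℝ} {μ : ℂ} (h : μ.im = 0) :
    ‖Complex.exp (Complex.I * t * μ)‖ = 1 := by
  rw [Complex.norm_exp]
  simp [h]

/-- State transfer from one of the vertices of the `2`-branch side can only go to its mirror
image, and then determines the limits of the eigenvalue phases. -/
theorem exists_phase_limits (m : ℕ) (hm : m ≠ 0)
    (hreal : ∀ μ : ℂ, μ ^ 6 - (m + 5) * μ ^ 4 + (3 * m + 5) * μ ^ 2 - 1 = 0 →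
      μ.im = 0 ∧ ‖μ‖ ≠ 1) {μ₀ : ℂ}
    (hμ₀ : μ₀ ^ 6 - (m + 5) * μ₀ ^ 4 + (3 * m + 5) * μ₀ ^ 2 - 1 = 0)
    {τ : ℕ → ℝ} {j : Fin 2} {a w : StarVertex 2 ⊕ StarVertex m}
    (ha : a = leftLeaf j ∨ a = leftMiddle j)
    (h : PGSTAlong (doubleSubdividedStar 2 m) τ a w) :
    ∃ γ : ℂ, Tendsto (fun k => Complex.exp (Complex.I * τ k)) atTop (𝓝 (-γ)) ∧
      ∀ μ : ℂ, μ ^ 6 - (m + 5) * μ ^ 4 + (3 * m + 5) * μ ^ 2 - 1 = 0 →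
        Tendsto (fun k => Complex.exp (Complex.I * τ k * μ)) atTop (𝓝 γ) := by
  obtain ⟨γ, hγ⟩ := h.exists_tendsto
  have hne := h.1
  have hanti := hγ _ 1 (adjMatrix_mulVec_antisymm m (μ := 1) (by norm_num))
  have hsymm : ∀ μ : ℂ, μ ^ 6 - (m + 5) * μ ^ 4 + (3 * m + 5) * μ ^ 2 - 1 = 0 →
      ∃ u v e' l' : ℂ, Tendsto (fun k => Complex.exp (Complex.I * τ k * μ) *
        branchVec m (fun _ => 1) (fun _ => μ) u v e' l' a) atTop
        (𝓝 (γ * branchVec m (fun _ => 1) (fun _ => μ) u v e' l' w)) := fun μ hμ => by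
    obtain ⟨u, v, e', l', hv⟩ := adjMatrix_mulVec_symm m hm hμ
    exact ⟨u, v, e', l', hγ _ _ hv⟩
  have hnorm : ∀ (μ x y : ℂ), μ.im = 0 → Tendsto (fun k => Complex.exp (Complex.I * τ k * μ) * x)
      atTop (𝓝 y) → ‖x‖ = ‖y‖ := fun μ x y hμ hxy => by
    refine tendsto_nhds_unique ?_ hxy.norm
    simp only [norm_mul, norm_exp_I_mul_mul hμ, one_mul]
    exact tendsto_const_nhds
  have hna := hnorm _ _ _ (by simp) hanti
  have hs : ∀ i : Fin 2, ‖(![1, -1] : Fin 2 → ℂ) i‖ = 1 := fun i => by fin_cases i <;> simp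
  have hs' : ∀ i i' : Fin 2, i ≠ i' → (![1, -1] : Fin 2 → ℂ) i' = -(![1, -1] : Fin 2 → ℂ) i :=
    fun i i' hi => by fin_cases i <;> fin_cases i' <;> simp at hi ⊢
  have hmul : ∀ {μ x y : ℂ}, x ≠ 0 → Tendsto (fun k => Complex.exp (Complex.I * τ k * μ) * x)
      atTop (𝓝 (y * x)) → Tendsto (fun k => Complex.exp (Complex.I * τ k * μ)) atTop (𝓝 y) := by
    intro μ x y hx hxy
    have := hxy.mul_const x⁻¹
    simpa only [mul_assoc, mul_inv_cancel₀ hx, mul_one] using this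
  have hs0 : (![1, -1] : Fin 2 → ℂ) j ≠ 0 := norm_ne_zero_iff.1 (by simp [hs])
  have hcancel : ∀ {f : ℕ → ℂ} {y : ℂ}, Tendsto (fun k => f k * (![1, -1] : Fin 2 → ℂ) j) atTop
      (𝓝 (y * (![1, -1] : Fin 2 → ℂ) j)) → Tendsto f atTop (𝓝 y) := by
    intro f y hf
    have := hf.mul_const ((![1, -1] : Fin 2 → ℂ) j)⁻¹
    simpa only [mul_assoc, mul_inv_cancel₀ hs0, mul_one] using this
  obtain ⟨u, v, e', l', h₀⟩ := hsymm μ₀ hμ₀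
  have hn₀ := hnorm _ _ _ (hreal μ₀ hμ₀).1 h₀
  -- Comparing moduli, the antisymmetric vector forces |γ| = 1 and puts `w` on the two branches. A
  -- leaf–middle transfer would then give ‖μ₀‖ = 1.
  rcases ha with rfl | rfl <;> rcases w with (_ | ⟨i, _ | _⟩) | (_ | ⟨i, _ | _⟩) <;>
    simp only [leftLeaf, leftMiddle, StarVertex.leaf, StarVertex.middle, branchVec, one_smul,
      norm_mul, hs, norm_one, mul_one, mul_zero, norm_zero, one_ne_zero] at *
  · rw [← hna, one_mul] at hn₀
    exact absurd hn₀.symm (hreal μ₀ hμ₀).2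
  · have hji : j ≠ i := by rintro rfl; exact hne rfl
    rw [hs' j i hji, mul_neg, ← neg_mul] at hanti
    refine ⟨γ, hcancel hanti, fun μ hμ => ?_⟩
    obtain ⟨-, -, -, -, h1⟩ := hsymm μ hμ
    exact h1
  · have hji : j ≠ i := by rintro rfl; exact hne rfl
    rw [hs' j i hji, mul_neg, ← neg_mul] at hanti
    refine ⟨γ, hcancel hanti, fun μ hμ => ?_⟩
    obtain ⟨-, -, -, -, h1⟩ := hsymm μ hμ
    refine hmul ?_ h1
    rintro rfl
    norm_num at hμ
  · rw [← hna] at hn₀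
    exact absurd hn₀ (hreal μ₀ hμ₀).2

/-! ### Roots of q and of its cubic -/

theorem cubic_roots_real (m : ℕ) (hm : 0 < m) :
    ∃ a b c : ℝ, 0 < a ∧ a < b ∧ b < c ∧ ∀ y ∈ ({a, b, c} : Set ℝ),
      y ^ 3 - (m + 5) * y ^ 2 + (3 * m + 5) * y - 1 = 0 := by
  have hm' : (0 : ℝ) < m := by exact_mod_cast hm
  let f : ℝ → ℝ := fun y => y ^ 3 - (m + 5) * y ^ 2 + (3 * m + 5) * y - 1
  have hf : Continuous f := by fun_prop
  -- The signs at 0, 1, 3, m + 5 alternate; f 1 = 2m and f 3 = -4.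
  have h0 : f 0 < 0 := by simp [f]
  have h1 : 0 < f 1 := by simp only [f]; linarith
  have h3 : f 3 < 0 := by simp only [f]; linarith
  have h5 : 0 < f (m + 5) := by simp only [f]; nlinarith
  obtain ⟨a, ha, ha'⟩ := intermediate_value_Ioo (by norm_num : (0 : ℝ) ≤ 1) hf.continuousOn ⟨h0, h1⟩
  obtain ⟨b, hb, hb'⟩ := intermediate_value_Ioo' (by norm_num : (1 : ℝ) ≤ 3) hf.continuousOn ⟨h3, h1⟩
  obtain ⟨c, hc, hc'⟩ := intermediate_value_Ioo (by linarith : (3 : ℝ) ≤ m + 5) hf.continuousOn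
    ⟨h3, h5⟩
  refine ⟨a, b, c, ha.1, ha.2.trans hb.1, hb.2.trans hc.1, ?_⟩
  rintro y (rfl | rfl | rfl)
  exacts [ha', hb', hc']

/-- The roots of `y ^ 3 - (m + 5) y ^ 2 + (3 m + 5) y - 1` are distinct and positive. -/
theorem cubic_factors_real (m : ℕ) (hm : 0 < m) (t : Fin 3 → ℂ)
    (h : ∀ y : ℂ, y ^ 3 - (m + 5) * y ^ 2 + (3 * m + 5) * y - 1 =
      (y - t 0) * (y - t 1) * (y - t 2)) :
    Function.Injective t ∧ ∀ i, ∃ r : ℝ, 0 < r ∧ t i = r := by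
  obtain ⟨a, b, c, ha, hab, hbc, hroot⟩ := cubic_roots_real m hm
  have hmem : ∀ y ∈ ({a, b, c} : Set ℝ), ∃ i, t i = y := by
    intro y hy
    have h1 : ((y : ℂ) - t 0) * (y - t 1) * (y - t 2) = 0 := by
      rw [← h]; exact_mod_cast hroot y hy
    rcases mul_eq_zero.1 h1 with h1 | h1
    · rcases mul_eq_zero.1 h1 with h1 | h1
      exacts [⟨0, (sub_eq_zero.1 h1).symm⟩, ⟨1, (sub_eq_zero.1 h1).symm⟩]
    · exact ⟨2, (sub_eq_zero.1 h1).symm⟩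
  obtain ⟨i, hi⟩ := hmem a (by simp)
  obtain ⟨j, hj⟩ := hmem b (by simp)
  obtain ⟨k, hk⟩ := hmem c (by simp)
  -- Three distinct real roots occupy three indices, so they exhaust `t`.
  let p : Fin 3 → Fin 3 := ![i, j, k]
  let r : Fin 3 → ℝ := ![a, b, c]
  have hr : Function.Injective r := by
    refine StrictMono.injective (Fin.strictMono_iff_lt_succ.2 fun i => ?_)
    fin_cases i
    exacts [hab, hbc]
  have hr0 : ∀ i, 0 < r i := by
    intro i; fin_cases i
    exacts [ha, ha.trans hab, (ha.trans hab).trans hbc]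
  have hp : ∀ n, t (p n) = r n := by
    intro n; fin_cases n
    exacts [hi, hj, hk]
  have hcomp : Function.Injective (t ∘ p) := fun x y hxy => hr (by
    simpa only [Function.comp, hp, Complex.ofReal_inj] using hxy)
  have hpinj : Function.Injective p := hcomp.of_comp
  have hpb := Finite.injective_iff_bijective.1 hpinj
  refine ⟨hcomp.of_comp_right hpb.2, fun n => ?_⟩
  obtain ⟨n, rfl⟩ := hpb.2 n
  exact ⟨r n, hr0 n, hp n⟩

theorem im_eq_zero_of_sq_eq_ofReal {z : ℂ} {r : ℝ} (hr : 0 < r) (h : z ^ 2 = r) : z.im = 0 := by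
  have h1 : z ^ 2 = ((Real.sqrt r : ℝ) : ℂ) ^ 2 := by
    rw [h, ← Complex.ofReal_pow, Real.sq_sqrt hr.le]
  rcases sq_eq_sq_iff_eq_or_eq_neg.1 h1 with rfl | rfl <;> simp

/-- A real root of modulus 1 is ±1, but q(±1) = 2m. -/
theorem norm_ne_one_of_root (m : ℕ) (hm : m ≠ 0) {μ : ℂ} (hi : μ.im = 0)
    (h : μ ^ 6 - (m + 5) * μ ^ 4 + (3 * m + 5) * μ ^ 2 - 1 = 0) : ‖μ‖ ≠ 1 := by
  intro hn
  have h2 : μ ^ 2 = 1 := by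
    have : μ = (μ.re : ℂ) := Complex.ext rfl (by simp [hi])
    rw [this] at hn ⊢
    rw [Complex.norm_real, Real.norm_eq_abs] at hn
    rw [← Complex.ofReal_pow, ← sq_abs, hn]; simp
  have : (2 * m : ℂ) = 0 := by
    rw [← h, show μ ^ 6 = (μ ^ 2) ^ 3 by ring, show μ ^ 4 = (μ ^ 2) ^ 2 by ring, h2]; ring
  simp [hm] at this

theorem qPoly_map_eq_prod (m : ℕ) {θ₁ θ₂ θ₃ : ℂ}
    (hθ : (qPoly m).aroots ℂ = {θ₁, -θ₁, θ₂, -θ₂, θ₃, -θ₃}) :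
    (qPoly m).map (algebraMap ℚ ℂ) =
      (X ^ 2 - C (θ₁ ^ 2)) * (X ^ 2 - C (θ₂ ^ 2)) * (X ^ 2 - C (θ₃ ^ 2)) := by
  have hmonic : ((qPoly m).map (algebraMap ℚ ℂ)).Monic := by
    rw [qPoly_map]; monicity!
  rw [(IsAlgClosed.splits _).eq_prod_roots_of_monic hmonic]
  rw [aroots] at hθ
  rw [hθ]
  simp
  ring

/-- The cubic polynomial with `q(x) = qCubic(x ^ 2)`. -/
noncomputable def qCubic (m : ℕ) : ℚ[X] :=
  X ^ 3 - C ((m : ℚ) + 5) * X ^ 2 + C (3 * (m : ℚ) + 5) * X - 1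

theorem qCubic_monic (m : ℕ) : (qCubic m).Monic := by
  rw [qCubic]; monicity!

theorem qCubic_natDegree (m : ℕ) : (qCubic m).natDegree = 3 := by
  rw [qCubic]; compute_degree!

/-- A rational root would be an integer dividing 1, but the values at 1 and -1 are 2m and -4m - 12.
-/
theorem qCubic_irreducible (m : ℕ) (hm : m ≠ 0) : Irreducible (qCubic m) := by
  rw [(qCubic_monic m).irreducible_iff_roots_eq_zero_of_degree_le_three
    (by rw [qCubic_natDegree]; norm_num) (qCubic_natDegree m).le]
  refine Multiset.eq_zero_of_forall_notMem fun r hr => ?_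
  have hr' : r ^ 3 - (m + 5) * r ^ 2 + (3 * m + 5) * r - 1 = 0 := by
    simpa [qCubic] using (mem_roots'.1 hr).2
  let p : ℤ[X] := X ^ 3 - C ((m : ℤ) + 5) * X ^ 2 + C (3 * (m : ℤ) + 5) * X - 1
  have hp : p.Monic := by simp only [p]; monicity!
  obtain ⟨n, hn⟩ := isInteger_of_is_root_of_monic hp (r := r) (by
    simp only [p, map_sub (aeval _), map_add (aeval _), map_mul (aeval _), map_pow (aeval _),
      aeval_X, aeval_C, map_one (aeval _), algebraMap_int_eq, Int.coe_castRingHom]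
    exact_mod_cast hr')
  have hn' : r = n := hn.symm
  subst hn'
  have hz : n ^ 3 - (m + 5) * n ^ 2 + (3 * m + 5) * n - 1 = 0 := by exact_mod_cast hr'
  have hu : IsUnit n := IsUnit.of_mul_eq_one (n ^ 2 - (m + 5) * n + (3 * m + 5)) (by linarith)
  rcases Int.isUnit_iff.1 hu with rfl | rfl <;> omega

theorem ne_neg_of_sq_injective {L : Type*} [Field L] {x : Fin 3 → L}
    (hinj : Function.Injective fun i => x i ^ 2) {i j : Fin 3}
    (hij : i ≠ j) : x i ≠ x j ∧ x i ≠ -x j :=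
  ⟨fun h => hij (hinj (by simp [h])), fun h => hij (hinj (by simp [h]))⟩

/-- A rational linear relation between three distinct numbers that is invariant under cyclic
shifts has equal coefficients. -/
theorem eq_of_cyclic_relation {L : Type*} [Field L] [CharZero L] {a b c N : ℤ} {u v w : L} (huv : u ≠ v)
    (h1 : a * u + b * v + c * w = N) (h2 : a * v + b * w + c * u = N)
    (h3 : a * w + b * u + c * v = N) : a = b ∧ b = c := by
  -- Eliminating N and w leaves the form p² + pq + q² in p = b - a, q = c - b, which is positive
  -- definite.
  have h4 : (((b - a) * (b - a) + (b - a) * (c - b) + (c - b) * (c - b) : ℤ) : L) * (v - u) = 0 := by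
    push_cast
    linear_combination ((c : L) - a) * (h1 - h2) - ((c : L) - b) * (h1 - h3)
  have h5 := (mul_eq_zero.1 h4).resolve_right (sub_ne_zero.2 huv.symm)
  have h6 : (b - a) * (b - a) + (b - a) * (c - b) + (c - b) * (c - b) = 0 := by exact_mod_cast h5
  have h7 : b - a = 0 := by
    have : 3 * (b - a) ^ 2 ≤ 0 := by nlinarith [sq_nonneg ((b - a) + 2 * (c - b))]
    nlinarith [sq_nonneg (b - a), pow_eq_zero_iff (n := 2) (a := b - a) (by norm_num)]
  have h8 : c - b = 0 := by
    rw [h7] at h6; simpa using h6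
  omega

/-! ### Galois action and integer relations -/

section Galois

variable {L : Type*} [Field L] [Algebra ℚ L]

/-- A square root of a root of `qCubic m` is irrational. -/
theorem ne_ratCast_of_aeval_qCubic {m : ℕ} (hm : m ≠ 0) {x : L} (hx : aeval (x ^ 2) (qCubic m) = 0)
    (r : ℚ) : x ≠ r := by
  rintro rfl
  have h1 : aeval (algebraMap ℚ L (r ^ 2)) (qCubic m) = 0 := by simpa using hx
  rw [aeval_algebraMap_apply, _root_.map_eq_zero, coe_aeval_eq_eval] at h1
  have := degree_eq_one_of_irreducible_of_root (qCubic_irreducible m hm) h1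
  rw [degree_eq_natDegree (qCubic_monic m).ne_zero, qCubic_natDegree] at this
  norm_num at this

variable {m : ℕ} {x : Fin 3 → L}

theorem aeval_qCubic_sq
    (hprod : ∀ y : L, aeval y (qCubic m) = (y - x 0 ^ 2) * (y - x 1 ^ 2) * (y - x 2 ^ 2))
    (i : Fin 3) : aeval (x i ^ 2) (qCubic m) = 0 := by
  rw [hprod]
  fin_cases i <;> simp

/-- Automorphisms permute the roots `x i ^ 2` of the cubic, hence the `x i` up to sign. -/
theorem exists_perm_sq
    (hprod : ∀ y : L, aeval y (qCubic m) = (y - x 0 ^ 2) * (y - x 1 ^ 2) * (y - x 2 ^ 2))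
    (hinj : Function.Injective fun i => x i ^ 2) (σ : L ≃ₐ[ℚ] L) :
    ∃ p : Equiv.Perm (Fin 3), ∀ i, σ (x i) = x (p i) ∨ σ (x i) = -x (p i) := by
  have h : ∀ i, ∃ j, σ (x i) ^ 2 = x j ^ 2 := by
    intro i
    have h1 : aeval (σ (x i ^ 2)) (qCubic m) = 0 := by
      rw [aeval_algHom_apply, aeval_qCubic_sq hprod, map_zero]
    rw [map_pow, hprod] at h1
    rcases mul_eq_zero.1 h1 with h1 | h1
    · rcases mul_eq_zero.1 h1 with h1 | h1
      exacts [⟨0, sub_eq_zero.1 h1⟩, ⟨1, sub_eq_zero.1 h1⟩]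
    · exact ⟨2, sub_eq_zero.1 h1⟩
  choose p hp using h
  have hpinj : Function.Injective p := fun i j hij => hinj (σ.injective (by
    simp only [map_pow, hp, hij]))
  refine ⟨Equiv.ofBijective p (Finite.injective_iff_bijective.1 hpinj), fun i => ?_⟩
  exact sq_eq_sq_iff_eq_or_eq_neg.1 (hp i)

/-- The squares share an irreducible minimal polynomial, so the action is transitive up to sign. -/
theorem exists_algEquiv_sq [Normal ℚ L] (hm : m ≠ 0)
    (hprod : ∀ y : L, aeval y (qCubic m) = (y - x 0 ^ 2) * (y - x 1 ^ 2) * (y - x 2 ^ 2))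
    (i j : Fin 3) : ∃ σ : L ≃ₐ[ℚ] L, σ (x i) = x j ∨ σ (x i) = -x j := by
  have hmin : minpoly ℚ (x i ^ 2) = qCubic m :=
    (minpoly.eq_of_irreducible_of_monic (qCubic_irreducible m hm) (aeval_qCubic_sq hprod i)
      (qCubic_monic m)).symm
  obtain ⟨σ, hσ⟩ := minpoly.exists_algEquiv_of_root' (K := ℚ) (x := x j ^ 2) (y := x i ^ 2)
    (Algebra.IsAlgebraic.isAlgebraic _) (by rw [hmin]; exact aeval_qCubic_sq hprod j)
  rw [map_pow] at hσ
  exact ⟨σ, sq_eq_sq_iff_eq_or_eq_neg.1 hσ⟩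

variable [CharZero L]

theorem aeval_qCubic (m : ℕ) (y : L) :
    aeval y (qCubic m) = y ^ 3 - (m + 5) * y ^ 2 + (3 * m + 5) * y - 1 := by
  simp only [qCubic, map_sub (aeval _), map_add (aeval _), map_mul (aeval _), map_pow (aeval _),
    aeval_X, aeval_C, map_one (aeval _), eq_ratCast]
  push_cast; ring

theorem prod_sq_eq_one
    (hprod : ∀ y : L, aeval y (qCubic m) = (y - x 0 ^ 2) * (y - x 1 ^ 2) * (y - x 2 ^ 2)) :
    (x 0 * x 1 * x 2) ^ 2 = 1 := by
  have := hprod 0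
  rw [aeval_qCubic] at this
  linear_combination this

/-- The product is ±1, hence rational. This is the parity constraint on sign changes. -/
theorem map_prod_eq
    (hprod : ∀ y : L, aeval y (qCubic m) = (y - x 0 ^ 2) * (y - x 1 ^ 2) * (y - x 2 ^ 2))
    (σ : L ≃ₐ[ℚ] L) : σ (x 0) * σ (x 1) * σ (x 2) = x 0 * x 1 * x 2 := by
  rw [← map_mul, ← map_mul]
  rcases eq_or_eq_neg_of_sq_eq_sq (x 0 * x 1 * x 2) 1 (by rw [prod_sq_eq_one hprod, one_pow]) with h | h <;> simp [h]

/-- If some automorphism negates `x 0`, then some automorphism fixes one of the `x i` and negates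
the other two. -/
theorem exists_algEquiv_neg
    (hprod : ∀ y : L, aeval y (qCubic m) = (y - x 0 ^ 2) * (y - x 1 ^ 2) * (y - x 2 ^ 2))
    (hinj : Function.Injective fun i => x i ^ 2) {σ : L ≃ₐ[ℚ] L} (hσ : σ (x 0) = -x 0) :
    ∃ (κ : L ≃ₐ[ℚ] L) (c : Fin 3), κ (x c) = x c ∧ ∀ i, i ≠ c → κ (x i) = -x i := by
  obtain ⟨p, hp⟩ := exists_perm_sq hprod hinj σ
  have hP := map_prod_eq hprod σ
  have hP0 : x 0 * x 1 * x 2 ≠ 0 := fun h => by simpa [h] using prod_sq_eq_one hprod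
  have hx0 : x 0 ≠ 0 := fun h => hP0 (by simp [h])
  have hx1 : x 1 ≠ 0 := fun h => hP0 (by simp [h])
  have hx2 : x 2 ≠ 0 := fun h => hP0 (by simp [h])
  have hp0 : p 0 = 0 := by
    by_contra hne
    have := ne_neg_of_sq_injective hinj hne
    rcases hp 0 with h | h <;> rw [hσ] at h
    · exact this.2 h.symm
    · exact this.1 (neg_injective h).symm
  have h2 : (2 : L) ≠ 0 := two_ne_zero
  have hp12 : (p 1 = 1 ∧ p 2 = 2) ∨ (p 1 = 2 ∧ p 2 = 1) := by
    have h01 : p 0 ≠ p 1 := p.injective.ne (by decide)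
    have h02 : p 0 ≠ p 2 := p.injective.ne (by decide)
    have h12 : p 1 ≠ p 2 := p.injective.ne (by decide)
    rw [hp0] at h01 h02
    generalize p 1 = a at *
    generalize p 2 = b at *
    clear hp hp0
    revert a b; decide
  -- By parity exactly one more sign changes. If σ fixes the indices it already works; if it swaps 1
  -- and 2, then σ² fixes `x 0` and negates the others.
  rcases hp12 with ⟨hp1, hp2⟩ | ⟨hp1, hp2⟩
  · rcases hp 1 with h1 | h1 <;> rcases hp 2 with h2' | h2' <;> rw [hp1] at h1 <;>
      rw [hp2] at h2' <;> rw [hσ, h1, h2'] at hP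
    · exact absurd (by linear_combination (-1 / 2) * hP) hP0
    · exact ⟨σ, 1, h1, fun i hi => by fin_cases i <;> simp_all⟩
    · exact ⟨σ, 2, h2', fun i hi => by fin_cases i <;> simp_all⟩
    · exact absurd (by linear_combination (-1 / 2) * hP) hP0
  · rcases hp 1 with h1 | h1 <;> rcases hp 2 with h2' | h2' <;> rw [hp1] at h1 <;>
      rw [hp2] at h2' <;> rw [hσ, h1, h2'] at hP
    · exact absurd (by linear_combination (-1 / 2) * hP) hP0
    · exact ⟨σ * σ, 0, by simp [AlgEquiv.mul_apply, hσ], fun i hi => by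
        fin_cases i <;> simp_all [AlgEquiv.mul_apply]⟩
    · exact ⟨σ * σ, 0, by simp [AlgEquiv.mul_apply, hσ], fun i hi => by
        fin_cases i <;> simp_all [AlgEquiv.mul_apply]⟩
    · exact absurd (by linear_combination (-1 / 2) * hP) hP0

/-- If `x 0` and `-x 0` are conjugate, then `1, x 0, x 1, x 2` are linearly independent over `ℚ`. -/
theorem eq_zero_of_intRelation_of_neg [Normal ℚ L] (hm : m ≠ 0)
    (hprod : ∀ y : L, aeval y (qCubic m) = (y - x 0 ^ 2) * (y - x 1 ^ 2) * (y - x 2 ^ 2))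
    (hinj : Function.Injective fun i => x i ^ 2) {σ : L ≃ₐ[ℚ] L} (hσ : σ (x 0) = -x 0)
    {l : Fin 3 → ℤ} {N : ℤ} (h : ∑ i, (l i : L) * x i = N) : l = 0 := by
  obtain ⟨κ, c, hc, hκ⟩ := exists_algEquiv_neg hprod hinj hσ
  funext k
  obtain ⟨τ, hτ⟩ := exists_algEquiv_sq hm hprod k c
  obtain ⟨p, hp⟩ := exists_perm_sq hprod hinj τ
  have hpk : p k = c := by
    by_contra hne
    have := ne_neg_of_sq_injective hinj hne
    rcases hp k with h | h <;> rcases hτ with h' | h' <;> rw [h] at h'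
    · exact this.1 h'
    · exact this.2 h'
    · exact this.2 (neg_eq_iff_eq_neg.1 h')
    · exact this.1 (neg_injective h')
  have hk : κ (τ (x k)) = τ (x k) := by
    rcases hτ with h | h <;> simp [h, hc]
  have hi : ∀ i, i ≠ k → κ (τ (x i)) = -τ (x i) := by
    intro i hik
    have : p i ≠ c := by rw [← hpk]; exact p.injective.ne hik
    rcases hp i with h | h <;> simp [h, hκ _ this]
  have e1 : ∑ i, (l i : L) * τ (x i) = N := by simpa using congrArg τ h
  have e2 : ∑ i, (l i : L) * κ (τ (x i)) = N := by simpa using congrArg κ e1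
  -- Adding the relation to its image under κ cancels every term but the k-th; irrationality then
  -- forces l k = 0.
  have e3 : (l k : L) * τ (x k) = N := by
    have : ∑ i, (l i : L) * (τ (x i) + κ (τ (x i))) = 2 * N := by
      simp only [mul_add, Finset.sum_add_distrib, e1, e2]; ring
    rw [Finset.sum_eq_single k (fun i _ hik => by rw [hi i hik]; ring) (by simp), hk] at this
    linear_combination (1 / 2) * this
  by_contra hlk
  have hl : (l k : L) ≠ 0 := by exact_mod_cast hlk
  have hroot : aeval (τ (x k) ^ 2) (qCubic m) = 0 := by
    rw [← map_pow, aeval_algHom_apply, aeval_qCubic_sq hprod, map_zero]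
  refine ne_ratCast_of_aeval_qCubic hm hroot ((N : ℚ) / l k) ?_
  push_cast
  rw [eq_div_iff hl, mul_comm, e3]

/-- If the sum of the `x i` is rational, then the automorphisms permute the `x i`. -/
theorem exists_perm_of_sum
    (hprod : ∀ y : L, aeval y (qCubic m) = (y - x 0 ^ 2) * (y - x 1 ^ 2) * (y - x 2 ^ 2))
    (hinj : Function.Injective fun i => x i ^ 2) {n : ℤ} (hn : x 0 + x 1 + x 2 = n)
    (σ : L ≃ₐ[ℚ] L) : ∃ p : Equiv.Perm (Fin 3), ∀ i, σ (x i) = x (p i) := by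
  obtain ⟨p, hp⟩ := exists_perm_sq hprod hinj σ
  have hP := map_prod_eq hprod σ
  have hP0 : x 0 * x 1 * x 2 ≠ 0 := fun h => by simpa [h] using prod_sq_eq_one hprod
  have hsum : σ (x 0) + σ (x 1) + σ (x 2) = x (p 0) + x (p 1) + x (p 2) := by
    have h1 : ∑ i, x (p i) = ∑ i, x i := Equiv.sum_comp p x
    rw [Fin.sum_univ_three, Fin.sum_univ_three] at h1
    rw [h1, hn, ← map_add, ← map_add, hn, map_intCast]
  have hprod' : x (p 0) * x (p 1) * x (p 2) = x 0 * x 1 * x 2 := by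
    have h1 : ∏ i, x (p i) = ∏ i, x i := Equiv.prod_comp p x
    rwa [Fin.prod_univ_three, Fin.prod_univ_three] at h1
  rw [← hprod'] at hP hP0
  have n01 := (ne_neg_of_sq_injective hinj (p.injective.ne (by decide : (0 : Fin 3) ≠ 1))).2
  have n02 := (ne_neg_of_sq_injective hinj (p.injective.ne (by decide : (0 : Fin 3) ≠ 2))).2
  have n12 := (ne_neg_of_sq_injective hinj (p.injective.ne (by decide : (1 : Fin 3) ≠ 2))).2
  refine ⟨p, ?_⟩
  rw [Fin.forall_fin_succ, Fin.forall_fin_succ, Fin.forall_fin_one]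
  change σ (x 0) = x (p 0) ∧ σ (x 1) = x (p 1) ∧ σ (x 2) = x (p 2)
  -- An odd number of sign changes contradicts the product; two of them would make two of the `x i`
  -- opposite by the invariant sum.
  rcases hp 0 with h0 | h0 <;> rcases hp 1 with h1 | h1 <;> rcases hp 2 with h2 | h2 <;>
    rw [h0, h1, h2] at hP hsum
  · exact ⟨h0, h1, h2⟩
  · exact absurd (by linear_combination (-1 / 2) * hP) hP0
  · exact absurd (by linear_combination (-1 / 2) * hP) hP0
  · exact absurd (by linear_combination (-1 / 2) * hsum) n12
  · exact absurd (by linear_combination (-1 / 2) * hP) hP0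
  · exact absurd (by linear_combination (-1 / 2) * hsum) n02
  · exact absurd (by linear_combination (-1 / 2) * hsum) n01
  · exact absurd (by linear_combination (-1 / 2) * hP) hP0

/-- If the sum of the `x i` is an integer, then all integral relations are multiples of it. -/
theorem eq_of_intRelation_of_sum [Normal ℚ L] (hm : m ≠ 0)
    (hprod : ∀ y : L, aeval y (qCubic m) = (y - x 0 ^ 2) * (y - x 1 ^ 2) * (y - x 2 ^ 2))
    (hinj : Function.Injective fun i => x i ^ 2) {n : ℤ} (hn : x 0 + x 1 + x 2 = n)
    {l : Fin 3 → ℤ} {N : ℤ} (h : ∑ i, (l i : L) * x i = N) : l 0 = l 1 ∧ l 1 = l 2 := by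
  have hperm : ∀ j, ∃ (σ : L ≃ₐ[ℚ] L) (p : Equiv.Perm (Fin 3)), p 0 = j ∧
      ∀ i, σ (x i) = x (p i) := by
    intro j
    obtain ⟨σ, hσ⟩ := exists_algEquiv_sq hm hprod 0 j
    obtain ⟨p, hp⟩ := exists_perm_of_sum hprod hinj hn σ
    refine ⟨σ, p, ?_, hp⟩
    by_contra hne
    have := ne_neg_of_sq_injective hinj hne
    rw [← hp] at this
    exact hσ.elim this.1 this.2
  have hperm3 : ∀ p : Equiv.Perm (Fin 3), (p 0 = 1 → (p 1 = 0 ∧ p 2 = 2) ∨ (p 1 = 2 ∧ p 2 = 0)) ∧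
      (p 0 = 2 → (p 1 = 0 ∧ p 2 = 1) ∨ (p 1 = 1 ∧ p 2 = 0)) := by decide
  have h01 : x 0 ≠ x 1 := (ne_neg_of_sq_injective hinj (by decide)).1
  have h02 : x 0 ≠ x 2 := (ne_neg_of_sq_injective hinj (by decide)).1
  rw [Fin.sum_univ_three] at h
  obtain ⟨σ, p, hp0, hp⟩ := hperm 1
  have e0 : σ (x 0) = x 1 := by rw [hp, hp0]
  have e1 := hp 1
  have e2 := hp 2
  have r1 := congrArg σ h
  simp only [map_add, map_mul, map_intCast] at r1
  -- A permutation with 0 ↦ 1 is a transposition or a 3-cycle, likewise for 0 ↦ 2. A 3-cycle gives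
  -- the cyclic relations; two transpositions equate the coefficients directly.
  rcases (hperm3 p).1 hp0 with ⟨h1, h2⟩ | ⟨h1, h2⟩ <;> rw [h1] at e1 <;> rw [h2] at e2
  · obtain ⟨τ, q, hq0, hq⟩ := hperm 2
    have f0 : τ (x 0) = x 2 := by rw [hq, hq0]
    have f1 := hq 1
    have f2 := hq 2
    have s1 := congrArg τ h
    simp only [map_add, map_mul, map_intCast] at s1
    rcases (hperm3 q).2 hq0 with ⟨h1', h2'⟩ | ⟨h1', h2'⟩ <;> rw [h1'] at f1 <;> rw [h2'] at f2
    · have s2 := congrArg τ s1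
      simp only [map_add, map_mul, map_intCast, f0, f1, f2] at s1 s2
      exact eq_of_cyclic_relation h01 h (by linear_combination s2) (by linear_combination s1)
    · rw [e0, e1, e2] at r1
      rw [f0, f1, f2] at s1
      have t1 : ((l 0 - l 1 : ℤ) : L) * (x 0 - x 1) = 0 := by
        push_cast; linear_combination h - r1
      have t2 : ((l 0 - l 2 : ℤ) : L) * (x 0 - x 2) = 0 := by
        push_cast; linear_combination h - s1
      have u1 := (mul_eq_zero.1 t1).resolve_right (sub_ne_zero.2 h01)
      have u2 := (mul_eq_zero.1 t2).resolve_right (sub_ne_zero.2 h02)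
      rw [Int.cast_eq_zero] at u1 u2
      omega
  · have r2 := congrArg σ r1
    simp only [map_add, map_mul, map_intCast, e0, e1, e2] at r1 r2
    exact eq_of_cyclic_relation h01 h (by linear_combination r1) (by linear_combination r2)

end Galois

/-! ### From integer relations to state transfer -/

/-- Kronecker's theorem at odd multiples of `π`. -/
theorem exists_seq_odd_mul_pi {ι : Type*} [Fintype ι] (θ : ι → ℂ) (him : ∀ i, (θ i).im = 0)
    (h : ∀ (l : ι → ℤ) (N : ℤ), ∑ i, (l i : ℂ) * θ i = N → Even N) :
    ∃ τ : ℕ → ℝ, (∀ k, τ k ∈ oddMultiplesOfPi) ∧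
      ∀ i, Tendsto (fun k => Complex.exp (Complex.I * τ k * θ i)) atTop (𝓝 1) := by
  have hpi : (2 * Real.pi * Complex.I : ℂ) ≠ 0 := Complex.two_pi_I_ne_zero
  have hclose : ∀ k : ℕ, ∃ n : ℕ, ∀ i,
      ‖Complex.exp (Complex.I * Real.pi * θ i) *
        Complex.exp (Complex.I * (2 * Real.pi : ℝ) * θ i) ^ n - 1‖ < 1 / ((k : ℝ) + 1) := by
    intro k
    -- At time (2n + 1)π the phase is exp(iπθ) · exp(2πiθ)^n. A character trivial on the step is a
    -- relation with integer value N, and its value at the base point is exp(iπN).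
    refine exists_norm_mul_pow_sub_one_lt (fun i => Complex.exp (Complex.I * (2 * Real.pi : ℝ) * θ i))
      (fun i => Complex.exp (Complex.I * Real.pi * θ i))
      (fun i => norm_exp_I_mul_mul (him i)) (fun i => norm_exp_I_mul_mul (him i)) (fun l hl => ?_)
      (by positivity)
    simp only [← Complex.exp_int_mul, ← Complex.exp_sum] at hl ⊢
    obtain ⟨N, hN⟩ := Complex.exp_eq_one_iff.1 hl
    have hsum : ∑ i, (l i : ℂ) * θ i = N := by
      refine mul_right_cancel₀ hpi ?_
      rw [← hN, Finset.sum_mul]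
      refine Finset.sum_congr rfl fun i _ => ?_
      push_cast; ring
    obtain ⟨M, hM⟩ := h l N hsum
    refine Complex.exp_eq_one_iff.2 ⟨M, ?_⟩
    calc ∑ i, (l i : ℂ) * (Complex.I * Real.pi * θ i)
        = (Real.pi * Complex.I) * ∑ i, (l i : ℂ) * θ i := by
          rw [Finset.mul_sum]
          exact Finset.sum_congr rfl fun i _ => by ring
      _ = M * (2 * Real.pi * Complex.I) := by rw [hsum, hM]; push_cast; ring
  choose n hn using hclose
  refine ⟨fun k => (2 * (n k : ℝ) + 1) * Real.pi, fun k => ⟨n k, by simp⟩, fun i => ?_⟩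
  rw [tendsto_iff_norm_sub_tendsto_zero]
  refine squeeze_zero (fun _ => norm_nonneg _) (fun k => ?_)
    (tendsto_one_div_add_atTop_nhds_zero_nat (𝕜 := ℝ))
  refine le_trans (le_of_eq ?_) (hn k i).le
  rw [← Complex.exp_nat_mul, ← Complex.exp_add]
  congr 3
  push_cast; ring

theorem exists_pgstAlong (m : ℕ) {θ₁ θ₂ θ₃ : ℂ}
    (hθ : (qPoly m).aroots ℂ = {θ₁, -θ₁, θ₂, -θ₂, θ₃, -θ₃})
    (hnodup : ((qPoly m).aroots ℂ).Nodup) (him : ∀ i, (![θ₁, θ₂, θ₃] i).im = 0)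
    (h : ∀ (l : Fin 3 → ℤ) (N : ℤ), ∑ i, (l i : ℂ) * ![θ₁, θ₂, θ₃] i = N → Even N) :
    ∃ τ : ℕ → ℝ, (∀ k, τ k ∈ oddMultiplesOfPi) ∧
      PGSTAlong (doubleSubdividedStar 2 m) τ (leftLeaf 0) (leftLeaf 1) ∧
      PGSTAlong (doubleSubdividedStar 2 m) τ (leftMiddle 0) (leftMiddle 1) := by
  obtain ⟨τ, hτ, hlim⟩ := exists_seq_odd_mul_pi _ him h
  refine ⟨τ, hτ, pgstAlong_of_tendsto m ((qPoly m).aroots ℂ).toFinset ?_ hτ ?_⟩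
  · have hmonic : ((qPoly m).map (algebraMap ℚ ℂ)).Monic := by
      rw [qPoly_map]; monicity!
    rw [Finset.prod, Multiset.toFinset_val, hnodup.dedup]
    exact (IsAlgClosed.splits _).eq_prod_roots_of_monic hmonic
  · have hneg : ∀ μ : ℂ, Tendsto (fun k => Complex.exp (Complex.I * τ k * μ)) atTop (𝓝 1) →
        Tendsto (fun k => Complex.exp (Complex.I * τ k * -μ)) atTop (𝓝 1) := fun μ hμ => by
      simpa [Complex.exp_neg] using hμ.inv₀ one_ne_zero
    have h0 := hlim 0
    have h1 := hlim 1
    have h2 := hlim 2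
    intro μ hμ
    rw [Multiset.mem_toFinset, hθ] at hμ
    simp only [Multiset.insert_eq_cons, Multiset.mem_cons, Multiset.mem_singleton] at hμ
    rcases hμ with rfl | rfl | rfl | rfl | rfl | rfl
    exacts [h0, hneg _ h0, h1, hneg _ h1, h2, hneg _ h2]

/-- The phases of θ₁ and -θ₁ are inverse, so γ² = 1; multiplying those of the θᵢ gives γ = γ³ =
(-γ)^n = -γ. -/
theorem tendsto_contradiction {τ : ℕ → ℝ} {θ₁ θ₂ θ₃ γ : ℂ} {n : ℤ} (hn : Odd n)
    (hsum : θ₁ + θ₂ + θ₃ = n)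
    (h0 : Tendsto (fun k => Complex.exp (Complex.I * τ k)) atTop (𝓝 (-γ)))
    (h1 : Tendsto (fun k => Complex.exp (Complex.I * τ k * θ₁)) atTop (𝓝 γ))
    (h1' : Tendsto (fun k => Complex.exp (Complex.I * τ k * -θ₁)) atTop (𝓝 γ))
    (h2 : Tendsto (fun k => Complex.exp (Complex.I * τ k * θ₂)) atTop (𝓝 γ))
    (h3 : Tendsto (fun k => Complex.exp (Complex.I * τ k * θ₃)) atTop (𝓝 γ)) : False := by
  have hsq : γ * γ = 1 := by
    refine tendsto_nhds_unique (h1.mul h1') ?_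
    simp only [← Complex.exp_add, mul_neg, add_neg_cancel, Complex.exp_zero]
    exact tendsto_const_nhds
  have hγ : γ ≠ 0 := by rintro rfl; simp at hsq
  have hprod : γ * γ * γ = (-γ) ^ n := by
    refine tendsto_nhds_unique ((h1.mul h2).mul h3)
      ((h0.zpow₀ n (Or.inl (neg_ne_zero.2 hγ))).congr fun k => ?_)
    rw [← Complex.exp_add, ← Complex.exp_add, ← mul_add, ← mul_add, hsum, ← Complex.exp_int_mul,
      mul_comm]
  obtain ⟨k, rfl⟩ := hn
  rw [zpow_add₀ (neg_ne_zero.2 hγ), zpow_mul, zpow_one, zpow_ofNat, neg_sq, pow_two, hsq, one_zpow,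
    one_mul, one_mul] at hprod
  exact hγ (self_eq_neg.1 hprod)

/-- In `T_{2,m}`, the leaves of the two branches on the `2`-branch side are `c = leftLeaf 0` and
`d = leftLeaf 1`, and their neighbours are `e = leftMiddle 0` and `f = leftMiddle 1`. -/
theorem theorem3p3 (m : ℕ) (hm : 0 < m) (θ₁ θ₂ θ₃ : ℂ)
    (hθ : (qPoly m).aroots ℂ = {θ₁, -θ₁, θ₂, -θ₂, θ₃, -θ₃}) :
    (Irreducible (qPoly m) →
      ∃ τ : ℕ → ℝ, (∀ k, τ k ∈ oddMultiplesOfPi) ∧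
        PGSTAlong (doubleSubdividedStar 2 m) τ (leftLeaf 0) (leftLeaf 1) ∧
        PGSTAlong (doubleSubdividedStar 2 m) τ (leftMiddle 0) (leftMiddle 1)) ∧
    (¬ Irreducible (qPoly m) →
      ((∃ n : ℤ, Even n ∧ θ₁ + θ₂ + θ₃ = (n : ℂ)) →
        ∃ τ : ℕ → ℝ, (∀ k, τ k ∈ oddMultiplesOfPi) ∧
          PGSTAlong (doubleSubdividedStar 2 m) τ (leftLeaf 0) (leftLeaf 1) ∧
          PGSTAlong (doubleSubdividedStar 2 m) τ (leftMiddle 0) (leftMiddle 1)) ∧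
      ((∃ n : ℤ, Odd n ∧ θ₁ + θ₂ + θ₃ = (n : ℂ)) →
        ∀ (j : Fin 2) (w : StarVertex 2 ⊕ StarVertex m),
          ¬ PGST (doubleSubdividedStar 2 m) (leftLeaf j) w ∧
          ¬ PGST (doubleSubdividedStar 2 m) (leftMiddle j) w)) := by
  have hm0 : m ≠ 0 := hm.ne'
  have hfac := qPoly_map_eq_prod m hθ
  have hq : ∀ μ : ℂ, μ ^ 6 - (m + 5) * μ ^ 4 + (3 * m + 5) * μ ^ 2 - 1 =
      (μ ^ 2 - θ₁ ^ 2) * (μ ^ 2 - θ₂ ^ 2) * (μ ^ 2 - θ₃ ^ 2) := by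
    intro μ
    have := congrArg (eval μ) hfac
    rw [qPoly_map] at this
    simpa using this
  set θ : Fin 3 → ℂ := ![θ₁, θ₂, θ₃] with hθdef
  have hcub : ∀ y : ℂ, y ^ 3 - (m + 5) * y ^ 2 + (3 * m + 5) * y - 1 =
      (y - θ 0 ^ 2) * (y - θ 1 ^ 2) * (y - θ 2 ^ 2) := by
    intro y
    obtain ⟨μ, rfl⟩ := IsAlgClosed.exists_pow_nat_eq y (n := 2) (by norm_num)
    change _ = (μ ^ 2 - θ₁ ^ 2) * (μ ^ 2 - θ₂ ^ 2) * (μ ^ 2 - θ₃ ^ 2)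
    rw [← hq]; ring
  obtain ⟨hinj, hpos⟩ := cubic_factors_real m hm (fun i => θ i ^ 2) hcub
  have him : ∀ i, (θ i).im = 0 := fun i => by
    obtain ⟨r, hr, h⟩ := hpos i
    exact im_eq_zero_of_sq_eq_ofReal hr h
  have hne0 : ∀ i, θ i ≠ 0 := fun i h0 => by
    obtain ⟨r, hr, h⟩ := hpos i
    rw [h0] at h
    have : (r : ℂ) = 0 := by rw [← h]; norm_num
    exact hr.ne' (by exact_mod_cast this)
  have hroot : ∀ i, aeval (θ i) (qPoly m) = 0 ∧ aeval (-θ i) (qPoly m) = 0 := fun i => by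
    rw [aeval_def, ← eval_map, aeval_def, ← eval_map, hfac]
    fin_cases i <;> simp [θ]
  have hnodup : ((qPoly m).aroots ℂ).Nodup := by
    have h01 := ne_neg_of_sq_injective hinj (by decide : (0 : Fin 3) ≠ 1)
    have h02 := ne_neg_of_sq_injective hinj (by decide : (0 : Fin 3) ≠ 2)
    have h12 := ne_neg_of_sq_injective hinj (by decide : (1 : Fin 3) ≠ 2)
    have h0 := hne0 0
    have h1 := hne0 1
    have h2 := hne0 2
    simp only [hθdef, Matrix.cons_val] at h01 h02 h12 h0 h1 h2
    rw [hθ]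
    simp only [Multiset.insert_eq_cons, Multiset.nodup_cons, Multiset.mem_cons,
      Multiset.mem_singleton, Multiset.nodup_singleton, not_or, neg_eq_iff_eq_neg, neg_neg,
      self_eq_neg]
    tauto
  -- A normal extension of ℚ containing the roots, so that conjugate elements are related by
  -- automorphisms.
  let K := algebraicClosure ℚ ℂ
  have : IsAlgClosure ℚ K := algebraicClosure.isAlgClosure ℚ ℂ
  have : Algebra.IsAlgebraic ℚ K := IsAlgClosure.isAlgebraic
  have : Normal ℚ K := IsAlgClosure.normal ℚ K
  have hmonic : (qPoly m).Monic := by rw [qPoly]; monicity!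
  have halg : ∀ i, θ i ∈ K := fun i =>
    mem_algebraicClosure_iff.2 ⟨qPoly m, hmonic.ne_zero, (hroot i).1⟩
  let x : Fin 3 → K := fun i => ⟨θ i, halg i⟩
  have hxinj : Function.Injective fun i => x i ^ 2 := fun i j hij =>
    hinj (congrArg (algebraMap K ℂ) hij)
  have hxprod : ∀ y : K, aeval y (qCubic m) = (y - x 0 ^ 2) * (y - x 1 ^ 2) * (y - x 2 ^ 2) := by
    intro y
    rw [aeval_qCubic]
    apply (algebraMap K ℂ).injective
    simp only [map_sub, map_mul, map_add, map_pow, map_natCast, map_ofNat, map_one]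
    exact hcub y
  have hrel : ∀ {l : Fin 3 → ℤ} {N : ℤ}, ∑ i, (l i : ℂ) * θ i = N → ∑ i, (l i : K) * x i = N := by
    intro l N h
    apply (algebraMap K ℂ).injective
    simpa [Fin.sum_univ_three] using h
  refine ⟨fun hirr => ?_, fun _ => ⟨?_, ?_⟩⟩
  · refine exists_pgstAlong m hθ hnodup him fun l N h => ?_
    have hx0 : ∀ y : K, aeval (y : ℂ) (qPoly m) = 0 → aeval y (qPoly m) = 0 := fun y hy => by
      apply (algebraMap K ℂ).injective
      rw [map_zero, ← hy]
      exact (aeval_algebraMap_apply ℂ y (qPoly m)).symm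
    -- Irreducibility makes `x 0` and `-x 0` conjugate, since q is even.
    have hmin : minpoly ℚ (x 0) = qPoly m :=
      (minpoly.eq_of_irreducible_of_monic hirr (hx0 _ (hroot 0).1) hmonic).symm
    obtain ⟨σ, hσ⟩ := minpoly.exists_algEquiv_of_root' (K := ℚ) (x := -x 0) (y := x 0)
      (Algebra.IsAlgebraic.isAlgebraic _) (by rw [hmin]; exact hx0 _ (hroot 0).2)
    have hl := eq_zero_of_intRelation_of_neg hm0 hxprod hxinj hσ (hrel h)
    have hN : (N : ℂ) = 0 := by rw [← h, hl]; simp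
    rw [Int.cast_eq_zero.1 hN]
    exact Even.zero
  · rintro ⟨n, hn, hsum⟩
    refine exists_pgstAlong m hθ hnodup him fun l N h => ?_
    have hxsum : x 0 + x 1 + x 2 = n := by
      apply (algebraMap K ℂ).injective
      simp only [map_add, map_intCast]
      exact hsum
    obtain ⟨h1, h2⟩ := eq_of_intRelation_of_sum hm0 hxprod hxinj hxsum (hrel h)
    have hN : N = l 0 * n := by
      have : (N : ℂ) = l 0 * n := by
        rw [← h, ← hsum, Fin.sum_univ_three, ← h2, ← h1]
        simp only [Matrix.cons_val]; ring
      exact_mod_cast this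
    rw [hN]
    exact hn.mul_left _
  · rintro ⟨n, hn, hsum⟩ j w
    have hreal : ∀ μ : ℂ, μ ^ 6 - (m + 5) * μ ^ 4 + (3 * m + 5) * μ ^ 2 - 1 = 0 →
        μ.im = 0 ∧ ‖μ‖ ≠ 1 := by
      intro μ hμ
      have hi : μ.im = 0 := by
        have h0 := hμ
        rw [hq] at h0
        have : ∃ i, μ ^ 2 = θ i ^ 2 := by
          rcases mul_eq_zero.1 h0 with h0 | h0
          · rcases mul_eq_zero.1 h0 with h0 | h0
            exacts [⟨0, sub_eq_zero.1 h0⟩, ⟨1, sub_eq_zero.1 h0⟩]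
          · exact ⟨2, sub_eq_zero.1 h0⟩
        obtain ⟨i, hi⟩ := this
        obtain ⟨r, hr, h⟩ := hpos i
        exact im_eq_zero_of_sq_eq_ofReal hr (hi.trans h)
      exact ⟨hi, norm_ne_one_of_root m hm0 hi hμ⟩
    have hr1 := hq θ₁
    have hr1' := hq (-θ₁)
    have hr2 := hq θ₂
    have hr3 := hq θ₃
    simp only [neg_sq θ₁, sub_self, zero_mul, mul_zero] at hr1 hr1' hr2 hr3
    have hno : ∀ a : StarVertex 2 ⊕ StarVertex m, a = leftLeaf j ∨ a = leftMiddle j →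
        ¬ PGST (doubleSubdividedStar 2 m) a w := by
      rintro a ha ⟨τ, hτ⟩
      obtain ⟨γ, h0, h⟩ := exists_phase_limits m hm0 hreal hr1 ha hτ
      exact tendsto_contradiction hn hsum h0 (h _ hr1) (h _ (by simpa using hr1')) (h _ hr2)
        (h _ hr3)
    exact ⟨hno _ (Or.inl rfl), hno _ (Or.inr rfl)⟩
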